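/- Let $T$ be a finite set of closed halfspaces $\{x : a\cdot x\le b\}$ ($a\neq 0$) in $\mathbb{R}^D$, and suppose that the polyhedron $P=\bigcap_{H\in T}H$ is full-dimensional and pointed (it has dimension $D$ and at least one vertex). The faces of $P$ are $\emptyset$, $P$ and the intersections of $P$ with its supporting hyperplanes; the dimension of a face is the dimension of its affine hull, with $\dim\emptyset=-1$, and a vertex is a $0$-dimensional face (identified with its point). For a (possibly inhomogeneous) linear function $\ell:\mathbb{R}^D\to\mathbb{R}$ and a set $Q\subseteq\mathbb{R}^D$, let $\min_\ell Q$ be the set of points of $Q$ at which $\ell$ attains its minimum over $Q$ (empty if there is no minimum). For $B\in\mathbb{R}$ let $P^{\ell<B}$ be the set of all faces $F$ of $P$ with $\ell(p)<B$ for every $p\in F$, and let $\dim P^{\ell<B}$ be the maximum dimension of a face in $P^{\ell<B}$. Suppose that $\min_\ell P$ is a single vertex of $P$, and that $\ell$ does not take the same value at two different vertices of $P$. Let $B\in\mathbb{R}$, let $d=\dim P^{\ell<B}$, and let $v$ be any vertex of $P$ belonging to $P^{\ell<B}$. Then there is a set $S\subseteq T$ of exactly $d$ halfspaces such that $$\min_\ell(P\cap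 A)=\{v\},$$ where $A=\bigcap_{H\in S}\partial H$ is the intersection of the boundary hyperplanes of the halfspaces in $S$ (and $A=\mathbb{R}^D$ if $S=\emptyset$). -/

import Mathlib

namespace BoundedFaces

noncomputable section

/-- Euclidean `D`-space. -/
abbrev Space (D : ℕ) := EuclideanSpace ℝ (Fin D)

/-- Closed halfspaces `{x | a x ≤ b}`, `a ≠ 0`. The boundary hyperplane of `H` is `frontier H`. -/
def IsClosedHalfspace {D : ℕ} (H : Set (Space D)) : Prop :=
  ∃ (a : Space D →ₗ[ℝ] ℝ) (b : ℝ), a ≠ 0 ∧ H = {x | a x ≤ b}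

/-- Faces of a polyhedron: the empty set, `P` itself, and the intersections of `P` with its
supporting hyperplanes. This is Mathlib's notion of an exposed subset: `F` is empty, or the set of
maximizers over `P` of some linear functional (the zero functional gives `P`). -/
def IsFace {D : ℕ} (P F : Set (Space D)) : Prop := IsExposed ℝ P F

open Classical in
/-- The dimension of the affine hull of `F`, with the convention `dim ∅ = -1`. -/
def dim {D : ℕ} (F : Set (Space D)) : ℤ :=
  if F = ∅ then -1 else (Module.finrank ℝ (vectorSpan ℝ F) : ℤ)

/-- A vertex is (the point of) a `0`-dimensional face. -/
def IsVertex {D : ℕ} (P : Set (Space D)) (v : Space D) : Prop := IsFace P {v}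

/-- `P` has at least one vertex. -/
def IsPointed {D : ℕ} (P : Set (Space D)) : Prop := ∃ v, IsVertex P v

/-- `P` has the dimension of the ambient space. -/
def IsFullDimensional {D : ℕ} (P : Set (Space D)) : Prop := dim P = D

/-- `min_ℓ P`: the set of points of `P` where `ℓ` attains its minimum over `P`
(empty if there is no minimum). -/
def minFace {D : ℕ} (l : Space D →ᵃ[ℝ] ℝ) (P : Set (Space D)) : Set (Space D) :=
  {x | x ∈ P ∧ ∀ y ∈ P, l x ≤ l y}

/-- `P^{ℓ<B}`: the set of faces of `P` all of whose points `p` satisfy `ℓ p < B`. -/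
def facesBelow {D : ℕ} (P : Set (Space D)) (l : Space D →ᵃ[ℝ] ℝ) (B : ℝ) :
    Set (Set (Space D)) :=
  {F | IsFace P F ∧ ∀ p ∈ F, l p < B}

/-- The dimension of a complex: the maximum dimension of a member. -/
def complexDim {D : ℕ} (C : Set (Set (Space D))) : ℤ := sSup (dim '' C)

theorem dim_le {D : ℕ} (F : Set (Space D)) : dim F ≤ D := by
  unfold dim
  split_ifs
  · omega
  · have h := Submodule.finrank_le (vectorSpan ℝ F)
    rw [finrank_euclideanSpace_fin] at h
    exact_mod_cast h

/-- The supremum in `complexDim` is an attained maximum. -/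
theorem isGreatest_complexDim {D : ℕ} {C : Set (Set (Space D))} (hC : C.Nonempty) :
    IsGreatest (dim '' C) (complexDim C) := by
  have hb : BddAbove (dim '' C) := ⟨D, by rintro _ ⟨F, -, rfl⟩; exact dim_le F⟩
  exact ⟨Int.csSup_mem (hC.image _) hb, fun k hk => le_csSup hb hk⟩

/-- The empty face belongs to `P^{ℓ<B}`. -/
theorem facesBelow_nonempty {D : ℕ} (P : Set (Space D)) (l : Space D →ᵃ[ℝ] ℝ) (B : ℝ) :
    (facesBelow P l B).Nonempty :=
  ⟨∅, fun h => absurd h Set.not_nonempty_empty, fun p hp => absurd hp (Set.notMem_empty p)⟩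

end

end BoundedFaces

/-! Write `c` for the linear part of `l`. Generic right hand sides turn the tangent cone at `v` into
a simple polyhedron. At a vertex of it with least `c`, the tight normals form a basis; let `e` be
the dual basis, so that the edges leave along `-e j`. If `0 < c (e j)`, this edge descends, so it
ends at no vertex and is a ray: `-e j` lies in the cone itself (`exists_adapted_basis`).

Let `K` consist of these `j`. Making the basis normals outside `K` tight gives a face with `l ≤ l v`
that contains segments along all `-e j`, `j ∈ K`, so `|K| ≤ d`. Making those in `K` tight leaves
only nonnegative terms in `l x - l v = ∑ a i (x - v) * c (e i)`, so `v` is a minimizer. It is the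
only one, because equality puts `x` on a face where `l` is constant (`eq_of_forall_face_eq`).
Padding `K` with basis normals up to size `d ≤ D` keeps `v` and only removes competitors. -/

namespace BoundedFaces

/-! ### Polyhedra given by inequalities, and generic perturbation -/

section Polyhedra

variable {V ι : Type*} [AddCommGroup V] [Module ℝ V]

/-- The polyhedron of the points `x` with `a i x ≤ b i` for all `i`. -/
def polyhedron (a : ι → Module.Dual ℝ V) (b : ι → ℝ) : Set V := {x | ∀ i, a i x ≤ b i}

/-- The normals of the constraints that are tight at `x` have no common zero but `0`. -/
def TightAt (a : ι → Module.Dual ℝ V) (b : ι → ℝ) (x : V) : Prop :=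
  ∀ y, (∀ i, a i x = b i → a i y = 0) → y = 0

variable {a : ι → Module.Dual ℝ V} {b : ι → ℝ}

/-- A ray that leaves the polyhedron does so through a constraint that it increases. -/
theorem exists_ray_exit [Finite ι] {x r : V} (hx : x ∈ polyhedron a b) (hr : ∃ i, 0 < a i r) :
    ∃ t : ℝ, 0 ≤ t ∧ x + t • r ∈ polyhedron a b ∧ ∃ i, 0 < a i r ∧ a i (x + t • r) = b i := by
  classical
  have := Fintype.ofFinite ι
  obtain ⟨i₀, hi₀⟩ := hr
  obtain ⟨k, hk, hmin⟩ := Finset.exists_min_image (Finset.univ.filter fun i => 0 < a i r)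
    (fun i => (b i - a i x) / a i r) ⟨i₀, by simpa using hi₀⟩
  simp only [Finset.mem_filter, Finset.mem_univ, true_and] at hk hmin
  have ht : 0 ≤ (b k - a k x) / a k r := div_nonneg (sub_nonneg.2 (hx k)) hk.le
  refine ⟨_, ht, fun i => ?_, k, hk, ?_⟩
  · rw [map_add, map_smul, smul_eq_mul]
    rcases le_or_gt (a i r) 0 with h | h
    · nlinarith [hx i, mul_nonneg ht (neg_nonneg.2 h)]
    · have := (le_div_iff₀ h).1 (hmin i h)
      linarith
  · rw [map_add, map_smul, smul_eq_mul, div_mul_cancel₀ _ hk.ne']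
    ring

/-- A direction that increases no tight constraint is feasible. -/
theorem exists_pos_add_smul_mem [Finite ι] {x r : V} (hx : x ∈ polyhedron a b)
    (hr : ∀ i, a i x = b i → a i r ≤ 0) : ∃ s : ℝ, 0 < s ∧ x + s • r ∈ polyhedron a b := by
  by_cases h : ∃ i, 0 < a i r
  · obtain ⟨t, ht, hmem, i, hi, hti⟩ := exists_ray_exit hx h
    refine ⟨t, lt_of_le_of_ne ht ?_, hmem⟩
    rintro rfl
    rw [zero_smul, add_zero] at hti
    exact absurd (hr i hti) (not_le.2 hi)
  · push Not at h
    refine ⟨1, one_pos, fun i => ?_⟩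
    rw [one_smul, map_add]
    linarith [hx i, h i]

/-- If a polyhedron contains no line, then every face of it contains a vertex. -/
theorem exists_tightAt [Finite ι] (ha : ∀ y, (∀ i, a i y = 0) → y = 0) {x : V}
    (hx : x ∈ polyhedron a b) :
    ∃ w ∈ polyhedron a b, (∀ i, a i x = b i → a i w = b i) ∧ TightAt a b w := by
  classical
  -- Induction on the number of slack constraints: moving inside the common kernel of the tight
  -- normals until exit makes one more tight.
  induction h : {i | a i x ≠ b i}.ncard using Nat.strong_induction_on generalizing x with
  | _ n ih =>
  by_cases hxt : TightAt a b x
  · exact ⟨x, hx, fun _ h => h, hxt⟩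
  simp only [TightAt, not_forall] at hxt
  obtain ⟨r, hr, hr0⟩ := hxt
  obtain ⟨r, hr, hpos⟩ : ∃ r, (∀ i, a i x = b i → a i r = 0) ∧ ∃ i, 0 < a i r := by
    obtain ⟨i, hi⟩ := not_forall.1 fun h => hr0 (ha r h)
    rcases lt_or_gt_of_ne hi with h | h
    · exact ⟨-r, fun j hj => by rw [map_neg, hr j hj, neg_zero], i, by rw [map_neg]; linarith⟩
    · exact ⟨r, hr, i, h⟩
  obtain ⟨t, -, hmem, k, hk, htk⟩ := exists_ray_exit hx hpos
  have hsub : ∀ i, a i x = b i → a i (x + t • r) = b i := fun i hi => by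
    rw [map_add, map_smul, hr i hi, smul_zero, add_zero, hi]
  have hlt : {i | a i (x + t • r) ≠ b i}.ncard < n := by
    rw [← h]
    refine Set.ncard_lt_ncard ⟨fun i hi hxi => hi (hsub i hxi), fun hle => ?_⟩
    exact hle (a := k) (fun hkx => hk.ne' (hr k hkx)) htk
  obtain ⟨w, hw, hwt, hwv⟩ := ih _ hlt hmem rfl
  exact ⟨w, hw, fun i hi => hwt i (hsub i hi), hwv⟩

/-- Such a point is determined by its set of tight constraints. -/
theorem finite_setOf_tightAt [Finite ι] : {w | TightAt a b w}.Finite := by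
  refine Set.Finite.of_finite_image (f := fun w => {i | a i w = b i}) (Set.toFinite _) ?_
  intro w hw w' _ h
  refine sub_eq_zero.1 (hw _ fun i hi => ?_)
  have : a i w' = b i := (Set.ext_iff.1 h i).1 hi
  rw [map_sub, hi, this, sub_self]

/-- For generic right hand sides, a solvable system of equations has independent left hand
sides. -/
theorem exists_generic_rhs [Finite ι] (a : ι → Module.Dual ℝ V) :
    ∃ β : ι → ℝ, ∀ (J : Finset ι) (y : V), (∀ i ∈ J, a i y = β i) →
      LinearIndependent ℝ fun i : J => a i := by
  classical
  have hdep : ∀ J : {J : Finset ι // ¬ LinearIndependent ℝ fun i : J => a i},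
      ∃ g : J.1 → ℝ, ∑ i, g i • a i = 0 ∧ ∃ i, g i ≠ 0 :=
    fun J => Fintype.not_linearIndependent_iff.1 J.2
  choose g hg hg0 using hdep
  let φ (J : {J : Finset ι // ¬ LinearIndependent ℝ fun i : J => a i}) : (ι → ℝ) →ₗ[ℝ] ℝ :=
    ∑ i : J.1, g J i • LinearMap.proj i.1
  have hφ : ∀ J β, φ J β = ∑ i : J.1, g J i * β i := fun J β => by simp [φ]
  -- A dependency among the normals in `J` confines solvable right hand sides to a proper subspace;
  -- finitely many of these cannot cover the space.
  have hne : ⋃ J, (LinearMap.ker (φ J) : Set (ι → ℝ)) ≠ Set.univ := by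
    intro h
    obtain ⟨J, hJ⟩ := Subspace.exists_eq_top_of_iUnion_eq_univ h
    obtain ⟨i, hi⟩ := hg0 J
    have := hφ J (Pi.single i.1 1)
    rw [LinearMap.ker_eq_top.1 hJ, Finset.sum_eq_single i] at this
    · simp at this
      exact hi this.symm
    · intro j _ hj
      rw [Pi.single_eq_of_ne (fun h => hj (Subtype.ext h)), mul_zero]
    · simp
  obtain ⟨β, hβ⟩ := (Set.ne_univ_iff_exists_notMem _).1 hne
  refine ⟨β, fun J y hy => by_contra fun hJ => hβ ?_⟩
  refine Set.mem_iUnion.2 ⟨⟨J, hJ⟩, ?_⟩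
  rw [SetLike.mem_coe, LinearMap.mem_ker, hφ]
  have := congrArg (fun f => f y) (hg ⟨J, hJ⟩)
  simp only [LinearMap.sum_apply, LinearMap.smul_apply, smul_eq_mul, LinearMap.zero_apply] at this
  rw [← this]
  exact Finset.sum_congr rfl fun i _ => by rw [hy i i.2]

/-- Independent functionals without common zeros have a dual basis. -/
theorem exists_dual_basis [FiniteDimensional ℝ V] (I : Finset ι)
    (hli : LinearIndependent ℝ fun i : I => a i) (hker : ∀ y, (∀ i ∈ I, a i y = 0) → y = 0) :
    ∃ e : Module.Basis I ℝ V, ∀ (i : I) (y : V), a i y = e.repr y i := by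
  classical
  have hspan : ⊤ ≤ Submodule.span ℝ (Set.range fun i : I => a i) := fun f _ => by
    refine mem_span_of_iInf_ker_le_ker fun y hy => ?_
    rw [hker y fun i hi => by simpa using (Submodule.mem_iInf _).1 hy ⟨i, hi⟩]
    exact map_zero f
  let f := Module.Basis.mk hli hspan
  let e := f.dualBasis.map (Module.evalEquiv ℝ V).symm
  refine ⟨e, fun i y => ?_⟩
  have : a i = e.coord i := e.ext fun j => by
    have hfi : a i = f i := by simp [f]
    rw [e.coord_apply, e.repr_self, Finsupp.single_apply, hfi, Module.Basis.map_apply,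
      Module.apply_evalEquiv_symm_apply, f.dualBasis_apply_self]
    exact if_congr eq_comm rfl rfl
  rw [this, e.coord_apply]

/-- A pointed full-dimensional cone `{y | ∀ i, a i y ≤ 0}` has a basis of normals such that each
vector of the dual basis on which `c` is positive is the negative of an element of the cone. -/
theorem exists_adapted_basis [Finite ι] [FiniteDimensional ℝ V] (a : ι → Module.Dual ℝ V)
    (ha : ∀ y, (∀ i, a i y = 0) → y = 0) {y₀ : V} (hy₀ : ∀ i, a i y₀ < 0) (c : Module.Dual ℝ V) :
    ∃ (I : Finset ι) (e : Module.Basis I ℝ V), (∀ (i : I) (y : V), a i y = e.repr y i) ∧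
      ∀ j, 0 < c (e j) → ∀ i, 0 ≤ a i (e j) := by
  classical
  have := Fintype.ofFinite ι
  obtain ⟨β, hβ⟩ := exists_generic_rhs a
  -- A large multiple of `y₀` satisfies every perturbed constraint.
  have hne : ∃ x, x ∈ polyhedron a β := by
    have hM : ∀ i, ∃ M : ℝ, 0 ≤ M ∧ a i (M • y₀) ≤ β i := fun i => by
      refine ⟨|β i| / -a i y₀, div_nonneg (abs_nonneg _) (by linarith [hy₀ i]), ?_⟩
      have h0 := (hy₀ i).ne
      have : a i ((|β i| / -a i y₀) • y₀) = -|β i| := by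
        rw [map_smul, smul_eq_mul]; field_simp
      rw [this]
      exact neg_abs_le _
    choose M hM0 hM using hM
    refine ⟨(∑ i, M i) • y₀, fun i => le_trans ?_ (hM i)⟩
    rw [map_smul, map_smul, smul_eq_mul, smul_eq_mul]
    exact mul_le_mul_of_nonpos_right
      (Finset.single_le_sum (fun j _ => hM0 j) (Finset.mem_univ i)) (hy₀ i).le
  obtain ⟨x, hx⟩ := hne
  obtain ⟨u, hu, -, hut⟩ := exists_tightAt ha hx
  -- The minimum is taken over vertices only, since `c` may be unbounded below on the polyhedron.
  obtain ⟨w, ⟨hw, hwt⟩, hwmin⟩ := Set.exists_min_image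
    {w | w ∈ polyhedron a β ∧ TightAt a β w} c
    ((finite_setOf_tightAt (a := a) (b := β)).subset fun _ h => h.2) ⟨u, hu, hut⟩
  let I : Finset ι := Finset.univ.filter fun i => a i w = β i
  have hI : ∀ i, i ∈ I ↔ a i w = β i := fun i => by simp [I]
  obtain ⟨e, he⟩ := exists_dual_basis I (hβ I w fun i hi => (hI i).1 hi)
    fun y hy => hwt y fun i hi => hy i ((hI i).2 hi)
  refine ⟨I, e, he, fun j hj => ?_⟩
  by_contra! hneg
  obtain ⟨i, hi⟩ := hneg
  obtain ⟨t, ht, hmem, k, hk, htk⟩ := exists_ray_exit (r := -e j) hw ⟨i, by simpa using hi⟩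
  rw [map_neg, neg_pos] at hk
  have hkI : k ∉ I := fun hkI => by
    have h := he ⟨k, hkI⟩ (e j)
    rw [e.repr_self, Finsupp.single_apply] at h
    split_ifs at h <;> linarith
  have ht' : t ≠ 0 := by
    rintro rfl
    exact hkI ((hI k).2 (by simpa using htk))
  have hle := hwmin _ ⟨hmem, fun y hy => ?_⟩
  · rw [map_add, map_smul, map_neg, smul_eq_mul] at hle
    have : 0 < t * c (e j) := mul_pos (lt_of_le_of_ne ht ht'.symm) hj
    linarith
  -- The endpoint of the edge is a vertex: the normals in `I` other than `j` stay tight there, and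
  -- `k` is nonzero on the remaining direction `e j`.
  · have h0 : ∀ i : I, i ≠ j → e.repr y i = 0 := fun i hij => by
      rw [← he]
      refine hy i ?_
      rw [map_add, map_smul, map_neg, he i (e j), e.repr_self,
        Finsupp.single_eq_of_ne hij, (hI i).1 i.2]
      simp
    have hye : y = e.repr y j • e j := by
      conv_lhs => rw [← e.sum_repr y]
      exact Finset.sum_eq_single j (fun i _ hij => by rw [h0 i hij, zero_smul]) (by simp)
    have hky := hy k htk
    rw [hye, map_smul, smul_eq_mul] at hky
    rw [hye, (mul_eq_zero.1 hky).resolve_right hk.ne, zero_smul]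

end Polyhedra

/-! ### Faces and vertices of the polyhedron -/

section Faces

variable {D : ℕ} {ι : Type*} {a : ι → Module.Dual ℝ (Space D)} {b : ι → ℝ}

theorem surjective_of_ne_zero {f : Module.Dual ℝ (Space D)} (hf : f ≠ 0) :
    Function.Surjective f.toContinuousLinearMap :=
  LinearMap.surjective hf

theorem frontier_halfspace {f : Module.Dual ℝ (Space D)} (hf : f ≠ 0) (r : ℝ) :
    frontier {x | f x ≤ r} = {x | f x = r} := by
  have h := f.toContinuousLinearMap.frontier_preimage (surjective_of_ne_zero hf) (Set.Iic r)
  rw [frontier_Iic] at h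
  exact h

theorem interior_halfspace {f : Module.Dual ℝ (Space D)} (hf : f ≠ 0) (r : ℝ) :
    interior {x | f x ≤ r} = {x | f x < r} := by
  have h := f.toContinuousLinearMap.interior_preimage (surjective_of_ne_zero hf) (Set.Iic r)
  rw [interior_Iic] at h
  exact h

/-- The sum of the normals in `J` exposes this set: its maximum is reached at `v`, and equality of
sums forces equality in each term. -/
theorem isFace_tight {J : Finset ι} {v : Space D} (hv : v ∈ polyhedron a b)
    (hJ : ∀ i ∈ J, a i v = b i) :
    IsFace (polyhedron a b) {x | x ∈ polyhedron a b ∧ ∀ i ∈ J, a i x = b i} := by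
  intro _
  refine ⟨(∑ i ∈ J, a i).toContinuousLinearMap, ?_⟩
  ext x
  simp only [Set.mem_ofPred_eq, LinearMap.coe_toContinuousLinearMap', LinearMap.sum_apply]
  refine and_congr_right fun hx => ⟨fun h y hy => ?_, fun h => ?_⟩
  · exact Finset.sum_le_sum fun i hi => (hy i).trans (h i hi).ge
  · have hsum : ∑ i ∈ J, (b i - a i x) = 0 := by
      refine le_antisymm ?_ (Finset.sum_nonneg fun i _ => sub_nonneg.2 (hx i))
      rw [Finset.sum_sub_distrib, ← Finset.sum_congr rfl hJ]
      exact sub_nonpos.2 (h v hv)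
    intro i hi
    exact (sub_eq_zero.1 ((Finset.sum_eq_zero_iff_of_nonneg
      fun i _ => sub_nonneg.2 (hx i)).1 hsum i hi)).symm

theorem isVertex_of_tightAt [Finite ι] {v : Space D} (hv : v ∈ polyhedron a b) (ht : TightAt a b v) :
    IsVertex (polyhedron a b) v := by
  classical
  have := Fintype.ofFinite ι
  have h := isFace_tight (J := Finset.univ.filter fun i => a i v = b i) hv (by simp)
  have heq : {x | x ∈ polyhedron a b ∧
      ∀ i ∈ Finset.univ.filter fun i => a i v = b i, a i x = b i} = {v} := by
    ext x
    refine ⟨fun hx => ?_, ?_⟩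
    · refine sub_eq_zero.1 (ht _ fun i hi => ?_)
      rw [map_sub, hi, hx.2 i (by simpa using hi), sub_self]
    · rintro rfl
      exact ⟨hv, by simp⟩
  rwa [heq] at h

theorem IsVertex.mem {P : Set (Space D)} {v : Space D} (hv : IsVertex P v) : v ∈ P := by
  obtain ⟨f, hf⟩ := hv ⟨v, rfl⟩
  exact ((Set.ext_iff.1 hf v).1 rfl).1

/-- Along a common zero of the tight normals one can move both ways, so the exposing functional is
constant there and would have a second maximizer. -/
theorem IsVertex.tightAt [Finite ι] {v : Space D} (hv : IsVertex (polyhedron a b) v) : TightAt a b v := by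
  obtain ⟨f, hf⟩ := hv ⟨v, rfl⟩
  have hmax := ((Set.ext_iff.1 hf v).1 rfl).2
  have key : ∀ y, (∀ i, a i v = b i → a i y = 0) → f y ≤ 0 := fun y hy => by
    obtain ⟨s, hs, hmem⟩ := exists_pos_add_smul_mem hv.mem fun i hi => (hy i hi).le
    have := hmax _ hmem
    rw [map_add, map_smul, smul_eq_mul] at this
    nlinarith
  intro y hy
  obtain ⟨s, hs, hmem⟩ := exists_pos_add_smul_mem hv.mem fun i hi => (hy i hi).le
  have h0 : 0 ≤ f y := by
    have := key (-y) fun i hi => by rw [map_neg, hy i hi, neg_zero]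
    rw [map_neg] at this
    linarith
  have : v + s • y ∈ ({v} : Set (Space D)) := by
    rw [hf]
    refine ⟨hmem, fun z hz => (hmax z hz).trans ?_⟩
    rw [map_add, map_smul, smul_eq_mul]
    nlinarith
  rw [Set.mem_singleton_iff, add_eq_left] at this
  exact (smul_eq_zero.1 this).resolve_left hs.ne'

theorem convex_polyhedron : Convex ℝ (polyhedron a b) := by
  intro x hx y hy s t hs ht hst i
  rw [map_add, map_smul, map_smul, smul_eq_mul, smul_eq_mul]
  calc s * a i x + t * a i y ≤ s * b i + t * b i :=
        add_le_add (mul_le_mul_of_nonneg_left (hx i) hs) (mul_le_mul_of_nonneg_left (hy i) ht)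
    _ = b i := by rw [← add_mul, hst, one_mul]

theorem IsFullDimensional.exists_strict (ha : ∀ i, a i ≠ 0)
    (hfull : IsFullDimensional (polyhedron a b)) : ∃ x, ∀ i, a i x < b i := by
  have hne : polyhedron a b ≠ ∅ := fun h => by
    simp only [IsFullDimensional, dim, h, if_true] at hfull
    omega
  have hspan : vectorSpan ℝ (polyhedron a b) = ⊤ := by
    refine Submodule.eq_top_of_finrank_eq ?_
    rw [finrank_euclideanSpace_fin]
    simpa [IsFullDimensional, dim, hne] using hfull
  obtain ⟨x, hx⟩ := convex_polyhedron.interior_nonempty_iff_affineSpan_eq_top.2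
    ((AffineSubspace.affineSpan_eq_top_iff_vectorSpan_eq_top_of_nonempty ℝ _ _
      (Set.nonempty_iff_ne_empty.2 hne)).2 hspan)
  refine ⟨x, fun i => ?_⟩
  have : x ∈ interior {x | a i x ≤ b i} := interior_mono (fun y (hy : y ∈ polyhedron a b) => hy i) hx
  rwa [interior_halfspace (ha i)] at this

variable [Finite ι]

/-- If `l` separates the vertices and its minimum is attained only at one point, then a face on
which `l` is constant is a vertex. -/
theorem eq_of_forall_face_eq (l : Space D →ᵃ[ℝ] ℝ) {v₀ : Space D}
    (hmin : minFace l (polyhedron a b) = {v₀})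
    (hgen : ∀ u w, IsVertex (polyhedron a b) u → IsVertex (polyhedron a b) w → l u = l w → u = w)
    {v : Space D} (hv : IsVertex (polyhedron a b) v) {p : ι → Prop} (hp : ∀ i, p i → a i v = b i)
    (hl : ∀ x ∈ polyhedron a b, (∀ i, p i → a i x = b i) → l x = l v)
    {x : Space D} (hx : x ∈ polyhedron a b) (hpx : ∀ i, p i → a i x = b i) : x = v := by
  have hline : ∀ y, (∀ i, a i y = 0) → y = 0 := fun y hy => hv.tightAt y fun i _ => hy i
  have hlv : ∀ y, l y = l.linear (y - v) + l v := fun y => by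
    have := l.map_vadd v (y - v)
    simpa using this
  have hc : l.linear (x - v) = 0 := by linarith [hlv x, hl x hx hpx]
  by_contra hne
  have hpos : ∃ i, 0 < a i (x - v) := by
    -- Otherwise `x - v` is a recession direction with `l` constant along it, and translating `v₀`
    -- gives a second minimizer.
    by_contra! hrec
    have hv₀ : v₀ ∈ minFace l (polyhedron a b) := hmin ▸ rfl
    have hmem : x - v + v₀ ∈ minFace l (polyhedron a b) := by
      refine ⟨fun i => ?_, fun y hy => ?_⟩
      · rw [map_add]
        linarith [hrec i, hv₀.1 i]
      · have := l.map_vadd v₀ (x - v)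
        simp only [vadd_eq_add, hc, zero_add] at this
        rw [this]
        exact hv₀.2 y hy
    rw [hmin, Set.mem_singleton_iff, add_eq_right] at hmem
    exact hne (sub_eq_zero.1 hmem)
  obtain ⟨t, -, hmem, k, hk, htk⟩ := exists_ray_exit hv.mem hpos
  obtain ⟨w, hw, hwt, hwv⟩ := exists_tightAt hline hmem
  have hpw : ∀ i, p i → a i w = b i := fun i hi => hwt i (by
    rw [map_add, map_smul, map_sub, hp i hi, hpx i hi, sub_self, smul_zero, add_zero])
  -- Constraint `k` is tight at `w`, but slack at `v` because `a k v < a k x`.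
  have hwv' := hgen w v (isVertex_of_tightAt hw hwv) hv (hl w hw hpw)
  have h1 := hwt k htk
  rw [hwv'] at h1
  rw [map_sub] at hk
  linarith [hx k]

/-- The basis `I` of tight normals at `v`, together with the part `S` of it such that `v`
minimizes `l` on every face cut out by constraints between `S` and `I`. -/
theorem exists_tight_subsets (l : Space D →ᵃ[ℝ] ℝ) {v₀ : Space D}
    (ha : ∀ i, a i ≠ 0) (hfull : IsFullDimensional (polyhedron a b))
    (hmin : minFace l (polyhedron a b) = {v₀})
    (hgen : ∀ u w, IsVertex (polyhedron a b) u → IsVertex (polyhedron a b) w → l u = l w → u = w)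
    {v : Space D} (hv : IsVertex (polyhedron a b) v) {B : ℝ} (hB : l v < B) :
    ∃ S I : Finset ι, S ⊆ I ∧ I.card = D ∧
      (S.card : ℤ) ≤ complexDim (facesBelow (polyhedron a b) l B) ∧
      (∀ i ∈ I, a i v = b i) ∧
      ∀ x ∈ polyhedron a b, (∀ i ∈ S, a i x = b i) → l v ≤ l x ∧ (l x ≤ l v → x = v) := by
  classical
  obtain ⟨x₀, hx₀⟩ := hfull.exists_strict ha
  have hlv : ∀ y, l y = l.linear (y - v) + l v := fun y => by
    have := l.map_vadd v (y - v)
    simpa using this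
  obtain ⟨I, e, he, hpos⟩ := exists_adapted_basis
    (fun i : {i // a i v = b i} => a i) (fun y hy => hv.tightAt y fun i hi => hy ⟨i, hi⟩)
    (y₀ := x₀ - v) (fun i => by rw [map_sub, i.2]; linarith [hx₀ i]) l.linear
  have hsum : ∀ y, l.linear y = ∑ i : I, a i y * l.linear (e i) := fun y => by
    conv_lhs => rw [← e.sum_repr y, map_sum]
    exact Finset.sum_congr rfl fun i _ => by rw [map_smul, smul_eq_mul, ← he]
  let K := Finset.univ.filter fun j : I => 0 < l.linear (e j)
  let N := Finset.univ.filter fun j : I => ¬ 0 < l.linear (e j)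
  let toι : I ↪ ι := ⟨fun j => j.1.1, fun i j h => Subtype.ext (Subtype.ext h)⟩
  have hterm : ∀ x ∈ polyhedron a b, (∀ i ∈ K.map toι, a i x = b i) →
      ∀ i ∈ Finset.univ (α := I), 0 ≤ a i (x - v) * l.linear (e i) := fun x hx hxK i _ => by
    by_cases hi : 0 < l.linear (e i)
    · have : a i x = b i := hxK i (Finset.mem_map.2 ⟨i, by simpa [K] using hi, rfl⟩)
      rw [map_sub, this, i.1.2, sub_self, zero_mul]
    · refine mul_nonneg_of_nonpos_of_nonpos ?_ (not_lt.1 hi)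
      rw [map_sub, i.1.2]
      linarith [hx i]
  refine ⟨K.map toι, Finset.univ.map toι, Finset.map_subset_map.2 (Finset.subset_univ _), ?_, ?_,
    ?_, fun x hx hxK => ⟨?_, fun hle => ?_⟩⟩
  · rw [Finset.card_map, Finset.card_univ, ← Module.finrank_eq_card_basis e,
      finrank_euclideanSpace_fin]
  · let F := {x | x ∈ polyhedron a b ∧ ∀ i ∈ N.map toι, a i x = b i}
    have hvF : ∀ i ∈ N.map toι, a i v = b i := fun i hi => by
      obtain ⟨j, -, rfl⟩ := Finset.mem_map.1 hi
      exact j.1.2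
    have hF : F ∈ facesBelow (polyhedron a b) l B := by
      refine ⟨isFace_tight hv.mem hvF, fun x hx => lt_of_le_of_lt ?_ hB⟩
      rw [hlv x, hsum]
      refine add_le_of_nonpos_left (Finset.sum_nonpos fun i _ => ?_)
      by_cases hi : 0 < l.linear (e i)
      · refine mul_nonpos_of_nonpos_of_nonneg ?_ hi.le
        rw [map_sub, i.1.2]
        linarith [hx.1 i]
      · have : a i x = b i := hx.2 i (Finset.mem_map.2 ⟨i, by simpa [N] using hi, rfl⟩)
        rw [map_sub, this, i.1.2, sub_self, zero_mul]
    refine le_trans ?_ ((isGreatest_complexDim ⟨F, hF⟩).2 ⟨F, hF, rfl⟩)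
    have hne : F ≠ ∅ := Set.nonempty_iff_ne_empty.1 ⟨v, hv.mem, hvF⟩
    rw [dim, if_neg hne, Finset.card_map, Nat.cast_le]
    have hli : LinearIndependent ℝ fun j : K => e j :=
      e.linearIndependent.comp _ Subtype.val_injective
    rw [← Fintype.card_coe, ← finrank_span_eq_card hli]
    refine Submodule.finrank_mono (Submodule.span_le.2 ?_)
    rintro _ ⟨j, rfl⟩
    have hj : 0 < l.linear (e j) := (Finset.mem_filter.1 j.2).2
    -- A short segment from `v` along `-e j` stays in `F`, so `e j` lies in its direction space.
    obtain ⟨s, hs, hmem⟩ := exists_pos_add_smul_mem (r := -e j) hv.mem fun i hi => by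
      rw [map_neg]
      exact neg_nonpos.2 (hpos j hj ⟨i, hi⟩)
    have hmemF : v + s • -e j ∈ F := by
      refine ⟨hmem, fun i hi => ?_⟩
      obtain ⟨k, hk, rfl⟩ := Finset.mem_map.1 hi
      have hkj : k ≠ j := by
        rintro rfl
        exact (Finset.mem_filter.1 hk).2 hj
      have h0 : a k (e j) = 0 := by rw [he, e.repr_self, Finsupp.single_eq_of_ne hkj]
      change a k _ = b k
      rw [map_add, map_smul, map_neg, h0, neg_zero, smul_zero, add_zero, k.1.2]
    have hvmem : v ∈ F := ⟨hv.mem, hvF⟩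
    have := vsub_mem_vectorSpan ℝ hvmem hmemF
    have h2 := Submodule.smul_mem _ s⁻¹ this
    simpa [hs.ne'] using h2
  · intro i hi
    obtain ⟨j, -, rfl⟩ := Finset.mem_map.1 hi
    exact j.1.2
  · rw [hlv x, hsum]
    exact le_add_of_nonneg_left (Finset.sum_nonneg (hterm x hx hxK))
  · rw [hlv x, hsum] at hle
    have h0 := (Finset.sum_eq_zero_iff_of_nonneg (hterm x hx hxK)).1
      (le_antisymm (by linarith) (Finset.sum_nonneg (hterm x hx hxK)))
    -- Only constraints with nonzero coefficient are imposed; their tightness already makes `l`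
    -- constant.
    refine eq_of_forall_face_eq l hmin hgen hv
      (p := fun i => ∃ j : I, toι j = i ∧ l.linear (e j) ≠ 0) ?_ (fun y hy hpy => ?_) hx ?_
    · rintro _ ⟨j, rfl, -⟩
      exact j.1.2
    · rw [hlv y, hsum, Finset.sum_eq_zero, zero_add]
      intro j _
      by_cases hj : l.linear (e j) = 0
      · rw [hj, mul_zero]
      · have : a j y = b j := hpy _ ⟨j, rfl, hj⟩
        rw [map_sub, this, j.1.2, sub_self, zero_mul]
    · rintro _ ⟨j, rfl, hj⟩
      have := (mul_eq_zero.1 (h0 j (Finset.mem_univ j))).resolve_right hj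
      rw [map_sub, j.1.2, sub_eq_zero] at this
      exact this

end Faces

end BoundedFaces

/-! ### Padding to exactly `d` halfspaces -/

theorem mainTheorem7 (D : ℕ) (T : Finset (Set (BoundedFaces.Space D)))
    (hT : ∀ H ∈ T, BoundedFaces.IsClosedHalfspace H)
    (P : Set (BoundedFaces.Space D)) (hP : P = ⋂ H ∈ T, H)
    (hfull : BoundedFaces.IsFullDimensional P) (hpointed : BoundedFaces.IsPointed P)
    (l : BoundedFaces.Space D →ᵃ[ℝ] ℝ)
    (hmin : ∃ v₀, BoundedFaces.IsVertex P v₀ ∧ BoundedFaces.minFace l P = {v₀})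
    (hgen : ∀ u w, BoundedFaces.IsVertex P u → BoundedFaces.IsVertex P w → l u = l w → u = w)
    (B : ℝ) (v : BoundedFaces.Space D) (hv : {v} ∈ BoundedFaces.facesBelow P l B) :
    ∃ S : Finset (Set (BoundedFaces.Space D)), S ⊆ T ∧
      (S.card : ℤ) = BoundedFaces.complexDim (BoundedFaces.facesBelow P l B) ∧
      BoundedFaces.minFace l (P ∩ ⋂ H ∈ S, frontier H) = {v} := by
  have hT' : ∀ H : T, ∃ (a : Module.Dual ℝ (BoundedFaces.Space D)) (b : ℝ),
      a ≠ 0 ∧ H.1 = {x | a x ≤ b} := fun H => hT H.1 H.2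
  choose a b ha hab using hT'
  obtain rfl : P = BoundedFaces.polyhedron a b := by
    ext x
    rw [hP, Set.mem_iInter₂]
    refine ⟨fun h i => ?_, fun h H hH => ?_⟩
    · have := h i i.2
      rwa [hab i] at this
    · exact (Set.ext_iff.1 (hab ⟨H, hH⟩) x).2 (h ⟨H, hH⟩)
  obtain ⟨v₀, -, hv₀⟩ := hmin
  have hvert : BoundedFaces.IsVertex _ v := hv.1
  obtain ⟨S, I, hSI, hI, hS, hIv, hmin⟩ :=
    BoundedFaces.exists_tight_subsets l ha hfull hv₀ hgen hvert (hv.2 v rfl)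
  obtain ⟨⟨F, -, hF⟩, -⟩ := BoundedFaces.isGreatest_complexDim
    (BoundedFaces.facesBelow_nonempty (BoundedFaces.polyhedron a b) l B)
  have hd : BoundedFaces.complexDim _ ≤ D := hF ▸ BoundedFaces.dim_le F
  -- The bound by `S.card` rules out the value `-1`.
  obtain ⟨d, hd'⟩ := Int.eq_ofNat_of_zero_le ((Nat.cast_nonneg S.card).trans hS)
  rw [hd'] at hS hd ⊢
  obtain ⟨S', hSS', hS'I, hcard⟩ :=
    Finset.exists_subsuperset_card_eq hSI (Nat.cast_le.1 hS) ((Nat.cast_le.1 hd).trans_eq hI.symm)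
  have hfr : ∀ x, x ∈ ⋂ H ∈ S'.map (Function.Embedding.subtype _), frontier H ↔
      ∀ i ∈ S', a i x = b i := fun x => by
    simp only [Set.mem_iInter, Finset.mem_map, forall_exists_index, and_imp,
      forall_apply_eq_imp_iff₂]
    refine forall₂_congr fun i _ => ?_
    change x ∈ frontier i.1 ↔ _
    rw [hab i, BoundedFaces.frontier_halfspace (ha i), Set.mem_ofPred_eq]
  have hvA : v ∈ BoundedFaces.polyhedron a b ∩
      ⋂ H ∈ S'.map (Function.Embedding.subtype _), frontier H :=
    ⟨hvert.mem, (hfr v).2 fun i hi => hIv i (hS'I hi)⟩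
  refine ⟨S'.map (Function.Embedding.subtype _), fun H hH => ?_, ?_, ?_⟩
  · obtain ⟨i, -, rfl⟩ := Finset.mem_map.1 hH
    exact i.2
  · rw [Finset.card_map, hcard]
  · ext x
    rw [Set.mem_singleton_iff]
    refine ⟨fun hx => ?_, ?_⟩
    · exact (hmin x hx.1.1 fun i hi => (hfr x).1 hx.1.2 i (hSS' hi)).2 (hx.2 v hvA)
    · rintro rfl
      exact ⟨hvA, fun y hy => (hmin y hy.1 fun i hi => (hfr y).1 hy.2 i (hSS' hi)).1⟩
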